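/- Let $\mathcal U$ be a structure in a first-order language (of any cardinality) that is $\kappa$-saturated for some uncountable cardinal $\kappa$; in particular, $\mathcal U$ may be any monster model of a complete theory. Call a formula $\phi(x;y)$ NIP if there do not exist an infinite set $A$ of $|x|$-tuples of $\mathcal U$ and, for each $I\subseteq A$, a $|y|$-tuple $b_I$ of $\mathcal U$ such that $\mathcal U\models\phi(a;b_I)\iff a\in I$ for all $a\in A$. Let $\Delta=\{\phi_i(x;y_i)\}$ be a countable set of NIP formulas. Let $S_\Delta(\mathcal U)$ be the space of $\Delta$-types over $\mathcal U$: its points are the sets $p$ of formulas of the form $\phi_i(x;b)$ or $\neg\phi_i(x;b)$, with $b$ a $|y_i|$-tuple of $\mathcal U$, such that $p$ is finitely satisfiable in $\mathcal U$ and contains $\phi_i(x;b)$ or $\neg\phi_i(x;b)$ for all $i$ and $b$; its topology is generated by the sets $\{p : \psi\in p\}$, for $\psi$ of the form $\phi_i(x;b)$ or $\neg\phi_i(x;b)$. Then $S_\Delta(\mathcal U)$ is sequentially compact: every sequence in $S_\Delta(\mathcal U)$ has a subsequence that converges in $S_\Delta(\mathcal U)$. -/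

import Mathlib

open scoped FirstOrder

universe u v w w₁ w₂ w₃

namespace DeltaTypes

open FirstOrder.Language Cardinal

variable {L : FirstOrder.Language.{u, v}} {α : Type w₁} {β : Type w₂}

/-- `U` is `κ`-saturated: every set of formulas in one free variable with parameters from a
subset `A` of `U` with fewer than `κ` elements that is finitely satisfiable in `U` is realized
in `U`. -/
def IsSaturated (L : FirstOrder.Language.{u, v}) (U : Type w) [L.Structure U] (κ : Cardinal.{w}) :
    Prop :=
  ∀ A : Set U, #A < κ → ∀ p : Set (L[[A]].Formula Unit),
    (∀ s : Finset (L[[A]].Formula Unit), (s : Set (L[[A]].Formula Unit)) ⊆ p →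
      ∃ a : Unit → U, ∀ ψ ∈ s, ψ.Realize a) →
    ∃ a : Unit → U, ∀ ψ ∈ p, ψ.Realize a

/-- The partitioned formula `φ(x; y)` is NIP in `U`: there do not exist an infinite set `A` of
`x`-tuples of `U` and `y`-tuples `b I`, for `I ⊆ A`, such that `φ(a; b I)` holds iff `a ∈ I`,
for all `a ∈ A`. -/
def IsNIP (U : Type w) [L.Structure U] (φ : L.Formula (α ⊕ β)) : Prop :=
  ¬ ∃ A : Set (α → U), A.Infinite ∧ ∃ b : Set (α → U) → (β → U),
    ∀ I : Set (α → U), I ⊆ A → ∀ a ∈ A, φ.Realize (Sum.elim a (b I)) ↔ a ∈ I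

/-- The instance `φ(x; b)` of `φ(x; y)`, a formula in `x` with parameters in `U`. -/
def inst {U : Type w} (φ : L.Formula (α ⊕ β)) (b : β → U) : L[[U]].Formula α :=
  BoundedFormula.subst ((L.lhomWithConstants U).onFormula φ)
    (Sum.elim Term.var fun j => (L.con (b j)).term)

theorem realize_inst {U : Type w} [L.Structure U] (φ : L.Formula (α ⊕ β)) (b : β → U)
    (a : α → U) : (inst φ b).Realize a ↔ φ.Realize (Sum.elim a b) := by
  unfold inst Formula.Realize
  rw [BoundedFormula.realize_subst]
  have h : (fun z : α ⊕ β => Term.realize a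
      ((Sum.elim Term.var (fun j => (L.con (b j)).term) : α ⊕ β → L[[U]].Term α) z))
      = Sum.elim a b := by
    funext z
    cases z with
    | inl _ => rfl
    | inr j => exact Term.realize_constants.trans rfl
  rw [h]
  exact LHom.realize_onFormula (L.lhomWithConstants U) φ

variable {ι : Type w₃} {γ : ι → Type w₂}

/-- The formulas `φ(x; b)` and `¬ φ(x; b)`, for `φ(x; y)` in `Δ` and `b` in `U`. -/
def deltaFormulas (U : Type w) (Δ : ∀ i, L.Formula (α ⊕ γ i)) : Set (L[[U]].Formula α) :=
  {ψ | ∃ (i : ι) (b : γ i → U), ψ = inst (Δ i) b ∨ ψ = ∼(inst (Δ i) b)}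

/-- The set `S_Δ(U)` of `Δ`-types over `U`: the sets of formulas `φ(x; b)`, `¬ φ(x; b)`, with
`φ(x; y)` in `Δ` and `b` in `U`, that are consistent with the elementary diagram of `U` (that is,
finitely satisfiable in `U`) and that decide every instance `φ(x; b)`. -/
@[ext]
structure DeltaType (U : Type w) [L.Structure U] (Δ : ∀ i, L.Formula (α ⊕ γ i)) where
  formulas : Set (L[[U]].Formula α)
  subset_deltaFormulas : formulas ⊆ deltaFormulas U Δ
  finitely_satisfiable : ∀ s : Finset (L[[U]].Formula α),
    (s : Set (L[[U]].Formula α)) ⊆ formulas → ∃ a : α → U, ∀ ψ ∈ s, ψ.Realize a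
  complete : ∀ (i : ι) (b : γ i → U), inst (Δ i) b ∈ formulas ∨ ∼(inst (Δ i) b) ∈ formulas

/-- The usual topology on `S_Δ(U)`, generated by the sets of all types that contain a given
formula `φ(x; b)` or `¬ φ(x; b)`. -/
instance (U : Type w) [L.Structure U] (Δ : ∀ i, L.Formula (α ⊕ γ i)) :
    TopologicalSpace (DeltaType U Δ) :=
  TopologicalSpace.generateFrom
    {O | ∃ ψ ∈ deltaFormulas U Δ, O = {p : DeltaType U Δ | ψ ∈ p.formulas}}

end DeltaTypes

/-! Suppose no subsequence of some sequence of types eventually decides every instance of one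
formula. For each m, Ramsey's theorem gives infinitely many indices all of whose increasing
2m-tuples have truth values made to alternate by some parameter; choosing the tuples suitably
shatters m of the types (`exists_convergent_or_shattered`). Finitely many instances in a type are
realized by a tuple, so m tuples are shattered as well, and saturation turns this into an infinite
shattered set (`not_isNIP_of_shatters`), against NIP. Since Δ is countable,
`exists_infinite_diagonal` yields one subsequence good for all its formulas. Its limit consists of
the formulas that eventually belong to the types; any finitely many of these lie together in a
single type, hence are satisfiable. -/

namespace DeltaTypes

open FirstOrder.Language Cardinal Filter

/-! ### Ramsey's theorem and alternation -/

section Combinatorics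

/-- A diagonal argument: if every infinite set of naturals has an infinite subset that is good
for `n`, then every infinite set `M` has an infinite subset `N` whose part above any `n ∈ N`
is good for `n`. -/
theorem exists_infinite_diagonal {R : ℕ → Set ℕ → Prop}
    (mono : ∀ n M N, N ⊆ M → R n M → R n N)
    (ex : ∀ n (M : Set ℕ), M.Infinite → ∃ N ⊆ M, N.Infinite ∧ R n N)
    {M : Set ℕ} (hM : M.Infinite) :
    ∃ N ⊆ M, N.Infinite ∧ ∀ n ∈ N, R n {m ∈ N | n < m} := by
  have step : ∀ S : {S : Set ℕ // S.Infinite}, ∃ T : {S : Set ℕ // S.Infinite},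
      T.1 ⊆ S.1 ∧ (∀ m ∈ T.1, sInf S.1 < m) ∧ R (sInf S.1) T.1 := by
    rintro ⟨S, hS⟩
    have hinf : (S \ Set.Iic (sInf S)).Infinite := hS.sdiff (Set.finite_Iic _)
    obtain ⟨T, hT, hTi, hR⟩ := ex (sInf S) _ hinf
    exact ⟨⟨T, hTi⟩, fun m hm => (hT hm).1, fun m hm => not_le.1 (hT hm).2, hR⟩
  choose F hsub hlt hR using step
  let S : ℕ → {S : Set ℕ // S.Infinite} := fun k => F^[k] ⟨M, hM⟩
  have hS : ∀ k, S (k + 1) = F (S k) := fun k => Function.iterate_succ_apply' F k _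
  have hanti : Antitone fun k => (S k).1 := antitone_nat_of_succ_le fun k => by
    rw [hS]; exact hsub _
  let a : ℕ → ℕ := fun k => sInf (S k).1
  have ha : ∀ k, a k ∈ (S k).1 := fun k => Nat.sInf_mem (S k).2.nonempty
  have hmem : ∀ {j k}, j < k → a k ∈ (F (S j)).1 := fun {j k} h => by
    rw [← hS]; exact hanti (Nat.succ_le_of_lt h) (ha k)
  have hmono : StrictMono a := fun j k h => hlt _ _ (hmem h)
  refine ⟨Set.range a, ?_, Set.infinite_range_of_injective hmono.injective, ?_⟩
  · rintro _ ⟨k, rfl⟩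
    exact hanti (Nat.zero_le k) (ha k)
  · rintro _ ⟨k, rfl⟩
    refine mono _ _ _ ?_ (hR (S k))
    rintro _ ⟨⟨j, rfl⟩, hj⟩
    exact hmem (hmono.lt_iff_lt.1 hj)

/-- The infinite Ramsey theorem for `k`-element sets of naturals and two colours. -/
theorem exists_infinite_homogeneous (k : ℕ) : ∀ (c : Finset ℕ → Prop) {M : Set ℕ}, M.Infinite →
    ∃ N ⊆ M, N.Infinite ∧ ((∀ s : Finset ℕ, ↑s ⊆ N → s.card = k → c s) ∨
      ∀ s : Finset ℕ, ↑s ⊆ N → s.card = k → ¬ c s) := by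
  induction k with
  | zero =>
    intro c M hM
    refine ⟨M, subset_rfl, hM, ?_⟩
    by_cases h : c ∅
    · exact Or.inl fun s _ hs => by rwa [Finset.card_eq_zero.1 hs]
    · exact Or.inr fun s _ hs => by rwa [Finset.card_eq_zero.1 hs]
  | succ k ih =>
    intro c M hM
    obtain ⟨N, hNM, hN, hR⟩ := exists_infinite_diagonal
      (R := fun n N => (∀ s : Finset ℕ, ↑s ⊆ N → s.card = k → c (insert n s)) ∨
        ∀ s : Finset ℕ, ↑s ⊆ N → s.card = k → ¬ c (insert n s))
      (fun n M N h => Or.imp (fun H s hs => H s (hs.trans h)) (fun H s hs => H s (hs.trans h)))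
      (fun n M hM => ih (fun s => c (insert n s)) hM) hM
    -- The colour of a (k+1)-subset of `N` now depends only on its minimum, so it remains to split
    -- `N` by the colour of the minimum.
    let P : Set ℕ := {n ∈ N | ∀ s : Finset ℕ, ↑s ⊆ {m ∈ N | n < m} → s.card = k → c (insert n s)}
    have key : ∀ (Q : Finset ℕ → Prop) (N' : Set ℕ), N' ⊆ N →
        (∀ n ∈ N', ∀ s : Finset ℕ, ↑s ⊆ {m ∈ N | n < m} → s.card = k → Q (insert n s)) →
        ∀ s : Finset ℕ, ↑s ⊆ N' → s.card = k + 1 → Q s := by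
      intro Q N' hN' h s hs hc
      have hne : s.Nonempty := Finset.card_pos.1 (by omega)
      have hmem := s.min'_mem hne
      rw [← Finset.insert_erase hmem]
      refine h _ (hs hmem) _ ?_ (by rw [Finset.card_erase_of_mem hmem, hc]; rfl)
      intro m hm
      rw [Finset.mem_coe] at hm
      exact ⟨hN' (hs (Finset.mem_of_mem_erase hm)), Finset.min'_lt_of_mem_erase_min' s hne hm⟩
    by_cases hP : P.Infinite
    · exact ⟨P, fun n hn => hNM hn.1, hP, Or.inl (key c P (fun n hn => hn.1) fun n hn => hn.2)⟩
    · refine ⟨N \ P, fun n hn => hNM hn.1, hN.sdiff (Set.not_infinite.1 hP),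
        Or.inr (key (fun s => ¬ c s) _ (fun n hn => hn.1) fun n hn => ?_)⟩
      exact (hR n hn.1).resolve_left fun h => hn.2 ⟨hn.1, h⟩

theorem card_filter_lt_image {a : ℕ → ℕ} (ha : StrictMono a) {j k : ℕ} (hj : j < k) :
    (((Finset.range k).image a).filter (· < a j)).card = j := by
  have : ((Finset.range k).image a).filter (· < a j) = (Finset.range j).image a := by
    ext x
    simp only [Finset.mem_filter, Finset.mem_image, Finset.mem_range]
    constructor
    · rintro ⟨⟨i, _, rfl⟩, h⟩
      exact ⟨i, ha.lt_iff_lt.1 h, rfl⟩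
    · rintro ⟨i, h, rfl⟩
      exact ⟨⟨i, h.trans hj, rfl⟩, ha h⟩
  rw [this, Finset.card_image_of_injective _ ha.injective, Finset.card_range]

variable {B : Type*}

/-- Either every infinite set of indices can be thinned out to one along which the sequence of
predicates `f` converges pointwise, or `m` members of the sequence are shattered. -/
theorem exists_convergent_or_shattered (f : ℕ → B → Prop) (m : ℕ) {M : Set ℕ} (hM : M.Infinite) :
    (∃ N ⊆ M, N.Infinite ∧ ∀ b, {n ∈ N | f n b}.Finite ∨ {n ∈ N | ¬ f n b}.Finite) ∨
      ∃ e : ℕ → ℕ, ∀ t : Set ℕ, ∃ b, ∀ i < m, f (e i) b ↔ i ∈ t := by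
  obtain ⟨N, hNM, hN, h⟩ := exists_infinite_homogeneous (2 * m)
    (fun s => ∃ b, ∀ x ∈ s, f x b ↔ Even (s.filter (· < x)).card) hM
  have himage : ∀ a : ℕ → ℕ, StrictMono a → (∀ n, a n ∈ N) →
      (↑((Finset.range (2 * m)).image a) ⊆ N ∧ ((Finset.range (2 * m)).image a).card = 2 * m) := by
    intro a ha haN
    refine ⟨fun x hx => ?_, by
      rw [Finset.card_image_of_injective _ ha.injective, Finset.card_range]⟩
    obtain ⟨j, _, rfl⟩ := Finset.mem_image.1 (Finset.mem_coe.1 hx)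
    exact haN j
  rcases h with h | h
  · right
    have hyes : ∀ a : ℕ → ℕ, StrictMono a → (∀ n, a n ∈ N) →
        ∃ b, ∀ j < 2 * m, f (a j) b ↔ Even j := by
      intro a ha haN
      obtain ⟨b, hb⟩ := h _ (himage a ha haN).1 (himage a ha haN).2
      refine ⟨b, fun j hj => ?_⟩
      rw [hb (a j) (Finset.mem_image_of_mem _ (Finset.mem_range.2 hj)), card_filter_lt_image ha hj]
    let e : ℕ → ℕ := Nat.nth (· ∈ N)
    have he : StrictMono e := Nat.nth_strictMono hN
    have heN : ∀ n, e n ∈ N := fun n => Nat.nth_mem_of_infinite hN n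
    refine ⟨fun i => e (3 * i + 1), fun t => ?_⟩
    classical
    -- From each block 3i, 3i+1, 3i+2 two indices are kept, always including 3i+1: it takes the even
    -- position if i ∈ t and the odd one otherwise, so alternation gives it the prescribed truth
    -- value.
    let g : ℕ → ℕ := fun j => 3 * (j / 2) + j % 2 + if j / 2 ∈ t then 1 else 0
    have hg : StrictMono g := strictMono_nat_of_lt_succ fun j => by
      rcases Nat.even_or_odd' j with ⟨i, rfl | rfl⟩
      · have h1 : 2 * i / 2 = i := by omega
        have h2 : (2 * i + 1) / 2 = i := by omega
        simp only [g, h1, h2]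
        omega
      · simp only [g]
        split_ifs <;> omega
    obtain ⟨b, hb⟩ := hyes (e ∘ g) (he.comp hg) fun n => heN _
    refine ⟨b, fun i hi => ?_⟩
    by_cases hit : i ∈ t
    · have h1 : g (2 * i) = 3 * i + 1 := by
        have : 2 * i / 2 = i := by omega
        simp [g, hit]
      have := hb (2 * i) (by omega)
      simp only [Function.comp_apply, h1] at this
      simp [this, hit]
    · have h1 : g (2 * i + 1) = 3 * i + 1 := by
        have : (2 * i + 1) / 2 = i := by omega
        simp only [g, this, hit, if_false]
        omega
      have := hb (2 * i + 1) (by omega)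
      simp only [Function.comp_apply, h1] at this
      simp [this, hit]
  · left
    refine ⟨N, hNM, hN, fun b => ?_⟩
    by_contra hcon
    simp only [not_or] at hcon
    obtain ⟨h1, h2⟩ := hcon
    -- Both truth values at `b` occur infinitely often in `N`, so an alternating sequence can be
    -- extracted, which the colour excludes.
    obtain ⟨a, ha, hab⟩ := extraction_forall_of_frequently
      (P := fun n k => k ∈ N ∧ (f k b ↔ Even n)) fun n => by
        rw [Nat.frequently_atTop_iff_infinite]
        by_cases hn : Even n
        · simpa [hn] using h1
        · simpa [hn] using h2
    refine h _ (himage a ha fun n => (hab n).1).1 (himage a ha fun n => (hab n).1).2 ⟨b, ?_⟩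
    intro x hx
    obtain ⟨j, hj, rfl⟩ := Finset.mem_image.1 hx
    rw [card_filter_lt_image ha (Finset.mem_range.1 hj)]
    exact (hab j).2

end Combinatorics

/-! ### Saturation for countably many variables -/

section Saturation

variable {L : FirstOrder.Language.{u, v}} {U : Type w} [L.Structure U]

theorem realize_congr_of_freeVars [DecidableEq α] (φ : L.Formula α) {x y : α → U}
    (h : ∀ i ∈ φ.freeVarFinset, x i = y i) : φ.Realize x ↔ φ.Realize y :=
  (BoundedFormula.realize_restrictFreeVar (f := Subtype.val) x fun _ => rfl).symm.trans
    (BoundedFormula.realize_restrictFreeVar (f := Subtype.val) y fun a => h a a.2)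

/-- For a finite set `s` of formulas in the variables `P ⊕ ℕ`, the statement that the values of
the first `k + 1` number variables can be completed to a realization of `s` is first-order. -/
theorem exists_formula_extends {P : Type*} (s : Finset (L.Formula (P ⊕ ℕ))) (k : ℕ) :
    ∃ θ : L.Formula ((P ⊕ ℕ) ⊕ Unit), ∀ (v : P → U) (c : ℕ → U) (d : U),
      θ.Realize (Sum.elim (Sum.elim v c) fun _ => d) ↔
        ∃ x : ℕ → U, (∀ i < k, x i = c i) ∧ x k = d ∧ ∀ ψ ∈ s, ψ.Realize (Sum.elim v x) := by
  classical
  let χ : L.Formula (P ⊕ ℕ) := Formula.iInf fun ψ : s => ψ.1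
  have hχ : ∀ y : P ⊕ ℕ → U, χ.Realize y ↔ ∀ ψ ∈ s, ψ.Realize y := fun y => by
    simp [χ, Formula.realize_iInf]
  obtain ⟨N, hN⟩ : ∃ N, ∀ n, Sum.inr n ∈ χ.freeVarFinset → n < N := by
    refine ⟨(χ.freeVarFinset.toRight).sup id + 1, fun n hn => Nat.lt_succ_of_le ?_⟩
    exact Finset.le_sup (f := id) (Finset.mem_toRight.2 hn)
  -- Variables at or beyond `N` do not occur in `χ`, so quantifying over `Fin N` suffices and their
  -- target is a dummy.
  let g : P ⊕ ℕ → ((P ⊕ ℕ) ⊕ Unit) ⊕ Fin N := Sum.elim (fun p => .inl (.inl (.inl p))) fun n =>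
    if n < k then .inl (.inl (.inr n)) else if n = k then .inl (.inr ()) else
      if h : n < N then .inr ⟨n, h⟩ else .inl (.inr ())
  refine ⟨(χ.relabel g).iExs (Fin N), fun v c d => ?_⟩
  rw [Formula.realize_iExs]
  simp only [Formula.realize_relabel, ← hχ]
  constructor
  · rintro ⟨i, hi⟩
    refine ⟨fun n => Sum.elim (Sum.elim (Sum.elim v c) fun _ => d) i (g (.inr n)), ?_, ?_, ?_⟩
    · intro n hn
      simp [g, hn]
    · simp [g]
    · convert hi using 1
      funext z
      rcases z with p | n <;> rfl
  · rintro ⟨x, hxc, hxd, hx⟩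
    refine ⟨fun i => x i, (realize_congr_of_freeVars χ ?_).2 hx⟩
    rintro (p | n) hn
    · rfl
    · have := hN n hn
      by_cases h1 : n < k
      · simp [g, h1, hxc]
      · by_cases h2 : n = k
        · subst h2; simp [g, hxd]
        · simp [g, h1, h2, this]

variable {κ : Cardinal.{w}} (hκ : ℵ₀ < κ) (hU : IsSaturated L U κ)
include hκ hU

theorem exists_realize_unit {Q : Type*} [Countable Q] (v : Q → U)
    (Γ : Set (L.Formula (Q ⊕ Unit)))
    (hΓ : ∀ s : Finset (L.Formula (Q ⊕ Unit)), ↑s ⊆ Γ →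
      ∃ d : U, ∀ ψ ∈ s, ψ.Realize (Sum.elim v fun _ => d)) :
    ∃ d : U, ∀ ψ ∈ Γ, ψ.Realize (Sum.elim v fun _ => d) := by
  classical
  let A : Set U := Set.range v
  let T : L.Formula (Q ⊕ Unit) → L[[A]].Formula Unit := fun ψ =>
    BoundedFormula.subst ((L.lhomWithConstants A).onFormula ψ)
      (Sum.elim (fun q => (L.con (⟨v q, q, rfl⟩ : A)).term) Term.var)
  have hT : ∀ ψ (a : Unit → U), (T ψ).Realize a ↔ ψ.Realize (Sum.elim v fun _ => a ()) := by
    intro ψ a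
    simp only [T]
    unfold Formula.Realize
    rw [BoundedFormula.realize_subst]
    have h : (fun z : Q ⊕ Unit => Term.realize a
        ((Sum.elim (fun q => (L.con (⟨v q, q, rfl⟩ : A)).term) Term.var :
          Q ⊕ Unit → L[[A]].Term Unit) z)) = Sum.elim v fun _ => a () := by
      funext z
      cases z with
      | inl _ => exact Term.realize_constants.trans rfl
      | inr j => rfl
    rw [h]
    exact LHom.realize_onFormula (L.lhomWithConstants A) ψ
  obtain ⟨a, ha⟩ := hU A ((Set.countable_range v).le_aleph0.trans_lt hκ) (T '' Γ) (by
    intro s hs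
    obtain ⟨s', hs', rfl⟩ := Finset.subset_set_image_iff.1 hs
    obtain ⟨d, hd⟩ := hΓ s' hs'
    refine ⟨fun _ => d, fun ψ hψ => ?_⟩
    obtain ⟨ψ', hψ', rfl⟩ := Finset.mem_image.1 hψ
    exact (hT _ _).2 (hd _ hψ'))
  exact ⟨a (), fun ψ hψ => (hT _ _).1 (ha _ ⟨ψ, hψ, rfl⟩)⟩

/-- Coordinates are chosen one at a time, keeping every finite part of `Γ` completable; each choice
realizes a one-variable type over countably many parameters. Each formula sees only finitely many
coordinates, so the limit realizes it. -/
theorem exists_realize_nat {P : Type*} [Countable P] (v : P → U) (Γ : Set (L.Formula (P ⊕ ℕ)))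
    (hΓ : ∀ s : Finset (L.Formula (P ⊕ ℕ)), ↑s ⊆ Γ →
      ∃ x : ℕ → U, ∀ ψ ∈ s, ψ.Realize (Sum.elim v x)) :
    ∃ x : ℕ → U, ∀ ψ ∈ Γ, ψ.Realize (Sum.elim v x) := by
  classical
  let Good : ℕ → (ℕ → U) → Prop := fun k c => ∀ s : Finset (L.Formula (P ⊕ ℕ)), ↑s ⊆ Γ →
    ∃ x : ℕ → U, (∀ i < k, x i = c i) ∧ ∀ ψ ∈ s, ψ.Realize (Sum.elim v x)
  have step : ∀ k c, Good k c → ∃ d, Good (k + 1) (Function.update c k d) := by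
    intro k c hc
    choose θ hθ using fun s : Finset (L.Formula (P ⊕ ℕ)) => exists_formula_extends (U := U) s k
    obtain ⟨d, hd⟩ := exists_realize_unit hκ hU (Sum.elim v c)
      (θ '' {s | (s : Set (L.Formula (P ⊕ ℕ))) ⊆ Γ}) (by
        intro S hS
        obtain ⟨S', hS', rfl⟩ := Finset.subset_set_image_iff.1 hS
        -- One completion for the union of the finite sets serves all the corresponding formulas `θ`
        -- at once.
        obtain ⟨x, hxc, hx⟩ := hc (S'.biUnion id) (by
          intro ψ hψ
          obtain ⟨s, hs, hψs⟩ := Finset.mem_biUnion.1 (Finset.mem_coe.1 hψ)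
          exact hS' hs hψs)
        refine ⟨x k, fun ψ hψ => ?_⟩
        obtain ⟨s, hs, rfl⟩ := Finset.mem_image.1 hψ
        exact (hθ _ _ _ _).2 ⟨x, hxc, rfl, fun ψ hψ => hx ψ (Finset.mem_biUnion.2 ⟨s, hs, hψ⟩)⟩)
    refine ⟨d, fun s hs => ?_⟩
    obtain ⟨x, hxc, hxk, hx⟩ := (hθ _ _ _ _).1 (hd _ ⟨s, hs, rfl⟩)
    refine ⟨x, fun i hi => ?_, hx⟩
    rcases Nat.lt_succ_iff_lt_or_eq.1 hi with h | rfl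
    · rw [Function.update_of_ne h.ne, hxc i h]
    · rw [Function.update_self, hxk]
  obtain ⟨x₀, -⟩ := hΓ ∅ (by simp)
  have : Nonempty U := ⟨x₀ 0⟩
  choose! F hF using step
  let C : ℕ → ℕ → U := fun k => Nat.rec x₀ (fun k c => Function.update c k (F k c)) k
  have hC : ∀ k, Good k (C k) := fun k => by
    induction k with
    | zero => exact fun s hs => (hΓ s hs).imp fun x hx => ⟨by simp, hx⟩
    | succ k ih => exact hF k _ ih
  have hstable : ∀ i k, i < k → C k i = C (i + 1) i := by
    intro i k hik
    induction k, Nat.succ_le_of_lt hik using Nat.le_induction with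
    | base => rfl
    | succ k hk ih =>
      exact (Function.update_of_ne (Nat.lt_of_succ_le hk).ne _ _).trans (ih hk)
  refine ⟨fun i => C (i + 1) i, fun ψ hψ => ?_⟩
  obtain ⟨x, hxc, hx⟩ := hC (ψ.freeVarFinset.toRight.sup id + 1) {ψ} (by simpa using hψ)
  refine (realize_congr_of_freeVars ψ ?_).1 (hx ψ (Finset.mem_singleton_self _))
  rintro (p | n) hn
  · rfl
  · have : n < ψ.freeVarFinset.toRight.sup id + 1 :=
      Nat.lt_succ_of_le (Finset.le_sup (f := id) (Finset.mem_toRight.2 hn))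
    exact (hxc n this).trans (hstable n _ this)

/-- In an uncountably saturated structure, finitely satisfiable families of formulas in countably
many variables and countably many parameters are realized. -/
theorem exists_realize_countable [Nonempty U] {P V J : Type*} [Countable P] [Countable V]
    (v : P → U) (ψ : J → L.Formula (P ⊕ V))
    (hψ : ∀ s : Finset J, ∃ x : V → U, ∀ j ∈ s, (ψ j).Realize (Sum.elim v x)) :
    ∃ x : V → U, ∀ j, (ψ j).Realize (Sum.elim v x) := by
  classical
  obtain ⟨e, he⟩ := exists_injective_nat V
  have hrel : ∀ j (x : ℕ → U), ((ψ j).relabel (Sum.map id e)).Realize (Sum.elim v x) ↔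
      (ψ j).Realize (Sum.elim v (x ∘ e)) := fun j x => by
    rw [Formula.realize_relabel, Sum.elim_comp_map, Function.comp_id]
  obtain ⟨x, hx⟩ := exists_realize_nat hκ hU v
    (Set.range fun j => (ψ j).relabel (Sum.map id e)) (by
      intro s hs
      rw [← Set.image_univ] at hs
      obtain ⟨s', -, rfl⟩ := Finset.subset_set_image_iff.1 hs
      obtain ⟨x, hx⟩ := hψ s'
      refine ⟨Function.extend e x fun _ => Classical.arbitrary U, fun χ hχ => ?_⟩
      obtain ⟨j, hj, rfl⟩ := Finset.mem_image.1 hχ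
      rw [hrel, Function.extend_comp he]
      exact hx j hj)
  exact ⟨x ∘ e, fun j => (hrel j x).1 (hx _ ⟨j, rfl⟩)⟩

/-- A formula that shatters arbitrarily large finite sets shatters an infinite one. -/
theorem not_isNIP_of_shatters (φ : L.Formula (α ⊕ β))
    (H : ∀ m : ℕ, ∃ (a : ℕ → α → U) (b : Finset ℕ → β → U), ∀ i < m, ∀ t ⊆ Finset.range m,
      φ.Realize (Sum.elim (a i) (b t)) ↔ i ∈ t) : ¬ IsNIP U φ := by
  classical
  have : Nonempty U := by
    by_contra hne
    rw [not_nonempty_iff] at hne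
    obtain ⟨a, b, h⟩ := H 1
    have h0 := h 0 one_pos ∅ (by simp)
    have h1 := h 0 one_pos {0} (by simp)
    rw [Subsingleton.elim (Sum.elim (a 0) (b ∅)) (Sum.elim (a 0) (b {0})), h1] at h0
    simp at h0
  let u₀ : Unit → U := fun _ => Classical.arbitrary U
  let X := {j : α // Sum.inl j ∈ φ.freeVarFinset}
  let Y := {l : β // Sum.inr l ∈ φ.freeVarFinset}
  have : Finite X := Finite.of_injective
    (fun j : X => (⟨Sum.inl j.1, j.2⟩ : φ.freeVarFinset)) fun i j h => by
      exact Subtype.ext (by simpa using h)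
  have : Finite Y := Finite.of_injective
    (fun j : Y => (⟨Sum.inr j.1, j.2⟩ : φ.freeVarFinset)) fun i j h => by
      exact Subtype.ext (by simpa using h)
  -- Tuples may be infinite, but only variables occurring in `φ` get unknowns, which keeps `V`
  -- countable; the others take the dummy value `u₀`.
  let V := (ℕ × X) ⊕ (Finset ℕ × Y)
  let ga : ℕ → α → Unit ⊕ V := fun n j => if h : _ then .inr (.inl (n, ⟨j, h⟩)) else .inl ()
  let gb : Finset ℕ → β → Unit ⊕ V := fun t l =>
    if h : _ then .inr (.inr (t, ⟨l, h⟩)) else .inl ()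
  let signed : ∀ {W : Type _}, Prop → L.Formula W → L.Formula W := fun p χ => if p then χ else ∼χ
  have hsigned : ∀ {W : Type _} (p : Prop) (χ : L.Formula W) (x : W → U),
      (signed p χ).Realize x ↔ (χ.Realize x ↔ p) := by
    intro W p χ x
    by_cases hp : p <;> simp [signed, hp]
  obtain ⟨z, hz⟩ := exists_realize_countable hκ hU u₀
    (fun q : ℕ × Finset ℕ => signed (q.1 ∈ q.2) (φ.relabel (Sum.elim (ga q.1) (gb q.2)))) (by
      intro s
      let m := s.sup Prod.fst + 1
      obtain ⟨a, b, h⟩ := H m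
      refine ⟨Sum.elim (fun q => a q.1 q.2.1) fun q => b (q.1 ∩ Finset.range m) q.2.1, ?_⟩
      rintro ⟨n, t⟩ hq
      have hn : n < m := Nat.lt_succ_of_le (Finset.le_sup (f := Prod.fst) hq)
      have := h n hn (t ∩ Finset.range m) Finset.inter_subset_right
      rw [hsigned, Formula.realize_relabel]
      simp only [Finset.mem_inter, Finset.mem_range, hn, and_true] at this
      rw [← this]
      refine realize_congr_of_freeVars φ ?_
      rintro (j | l) hj
      · simp [ga, hj]
      · simp [gb, hj])
  let a : ℕ → α → U := fun n => Sum.elim u₀ z ∘ ga n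
  let b : Finset ℕ → β → U := fun t => Sum.elim u₀ z ∘ gb t
  have hab : ∀ n t, φ.Realize (Sum.elim (a n) (b t)) ↔ n ∈ t := by
    intro n t
    have := hz (n, t)
    rwa [hsigned, Formula.realize_relabel, Sum.comp_elim] at this
  have hinj : Function.Injective a := by
    intro n k hnk
    have h1 := hab n {k}
    have h2 := hab k {k}
    rw [hnk, h2] at h1
    simpa using h1.symm
  -- There may be uncountably many `I`, so each is treated separately, over the countably many
  -- parameters already found; finite subsets of `I` witness finite satisfiability.
  have hI : ∀ I : Set ℕ, ∃ c : β → U, ∀ n, φ.Realize (Sum.elim (a n) c) ↔ n ∈ I := by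
    intro I
    let gc : β → (Unit ⊕ V) ⊕ Y := fun l => if h : _ then .inr ⟨l, h⟩ else .inl (.inl ())
    obtain ⟨y, hy⟩ := exists_realize_countable hκ hU (Sum.elim u₀ z)
      (fun n : ℕ => signed (n ∈ I) (φ.relabel (Sum.elim (Sum.inl ∘ ga n) gc))) (by
        intro s
        refine ⟨fun l => b (s.filter (· ∈ I)) l.1, fun n hn => ?_⟩
        have := hab n (s.filter (· ∈ I))
        simp only [Finset.mem_filter, hn, true_and] at this
        rw [hsigned, Formula.realize_relabel, ← this]
        refine realize_congr_of_freeVars φ ?_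
        rintro (j | l) hj
        · rfl
        · simp [gc, hj])
    refine ⟨Sum.elim (Sum.elim u₀ z) y ∘ gc, fun n => ?_⟩
    have := hy n
    rwa [hsigned, Formula.realize_relabel, Sum.comp_elim, ← Function.comp_assoc,
      Sum.elim_comp_inl] at this
  choose c hc using hI
  refine not_not.2 ⟨Set.range a, Set.infinite_range_of_injective hinj,
    fun I => c {n | a n ∈ I}, ?_⟩
  rintro I - _ ⟨n, rfl⟩
  exact hc _ n

end Saturation

/-! ### Convergence of types -/

section Convergence

variable {L : FirstOrder.Language.{u, v}} {U : Type w} [L.Structure U]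
  {α : Type w₁} {ι : Type w₃} {γ : ι → Type w₂} {Δ : ∀ i, L.Formula (α ⊕ γ i)}

theorem DeltaType.exists_realize (p : DeltaType U Δ) (i : ι) (s : Finset (γ i → U)) :
    ∃ a : α → U, ∀ b ∈ s, (Δ i).Realize (Sum.elim a b) ↔ inst (Δ i) b ∈ p.formulas := by
  classical
  obtain ⟨a, ha⟩ := p.finitely_satisfiable
    (s.image fun b => if inst (Δ i) b ∈ p.formulas then inst (Δ i) b else ∼(inst (Δ i) b)) (by
      intro ψ hψ
      obtain ⟨b, -, rfl⟩ := Finset.mem_image.1 (Finset.mem_coe.1 hψ)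
      split_ifs with h
      · exact h
      · exact (p.complete i b).resolve_left h)
  refine ⟨a, fun b hb => ?_⟩
  have := ha _ (Finset.mem_image_of_mem _ hb)
  rw [← realize_inst]
  by_cases h : inst (Δ i) b ∈ p.formulas
  · simpa [h] using this
  · simpa [h] using this

/-- A sequence of types that eventually decides every instance converges. -/
theorem DeltaType.exists_tendsto (p : ℕ → DeltaType U Δ)
    (hp : ∀ i b, (∀ᶠ n in atTop, inst (Δ i) b ∈ (p n).formulas) ∨
      ∀ᶠ n in atTop, inst (Δ i) b ∉ (p n).formulas) :
    ∃ q : DeltaType U Δ, Tendsto p atTop (nhds q) := by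
  refine ⟨⟨{ψ | ∀ᶠ n in atTop, ψ ∈ (p n).formulas}, fun ψ hψ => ?_, fun s hs => ?_,
    fun i b => ?_⟩, ?_⟩
  · obtain ⟨n, hn⟩ := Eventually.exists (f := atTop) hψ
    exact (p n).subset_deltaFormulas hn
  · obtain ⟨n, hn⟩ := ((Finset.eventually_all s).2 fun ψ hψ => hs hψ).exists
    exact (p n).finitely_satisfiable s fun ψ hψ => hn ψ hψ
  · exact (hp i b).imp id fun h => h.mono fun n hn => ((p n).complete i b).resolve_left hn
  · rw [TopologicalSpace.tendsto_nhds_generateFrom_iff]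
    rintro _ ⟨ψ, -, rfl⟩ hψ
    exact hψ

variable {κ : Cardinal.{w}} (hκ : ℵ₀ < κ) (hU : IsSaturated L U κ)
include hκ hU

theorem exists_infinite_convergent (p : ℕ → DeltaType U Δ) (i : ι) (hi : IsNIP U (Δ i))
    {M : Set ℕ} (hM : M.Infinite) :
    ∃ N ⊆ M, N.Infinite ∧ ∀ b, {n ∈ N | inst (Δ i) b ∈ (p n).formulas}.Finite ∨
      {n ∈ N | inst (Δ i) b ∉ (p n).formulas}.Finite := by
  classical
  by_contra hcon
  refine not_isNIP_of_shatters hκ hU (Δ i) (fun m => ?_) hi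
  obtain ⟨e, he⟩ := (exists_convergent_or_shattered
    (fun n b => inst (Δ i) b ∈ (p n).formulas) m hM).resolve_left hcon
  choose b hb using he
  choose a ha using fun k => (p (e k)).exists_realize i
    ((Finset.range m).powerset.image fun t : Finset ℕ => b (t : Set ℕ))
  refine ⟨a, fun t => b (t : Set ℕ), fun k hk t ht => ?_⟩
  rw [ha k _ (Finset.mem_image_of_mem (fun t : Finset ℕ => b (t : Set ℕ)) (Finset.mem_powerset.2 ht)), hb _ k hk, Finset.mem_coe]

/-- Every sequence of `Δ`-types, for `Δ` a countable set of NIP formulas, has an infinite set of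
indices along which it converges. -/
theorem exists_infinite_convergent_all [Countable ι] (hΔ : ∀ i, IsNIP U (Δ i))
    (p : ℕ → DeltaType U Δ) :
    ∃ N : Set ℕ, N.Infinite ∧ ∀ i b, {n ∈ N | inst (Δ i) b ∈ (p n).formulas}.Finite ∨
      {n ∈ N | inst (Δ i) b ∉ (p n).formulas}.Finite := by
  obtain ⟨e, he⟩ := exists_injective_nat ι
  let C : ι → Set ℕ → Prop := fun i N => ∀ b, {n ∈ N | inst (Δ i) b ∈ (p n).formulas}.Finite ∨
      {n ∈ N | inst (Δ i) b ∉ (p n).formulas}.Finite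
  have hC : ∀ {i M N}, N ⊆ M → C i M → C i N := fun {i M N} h H b =>
    (H b).imp (fun h' => h'.subset fun n hn => ⟨h hn.1, hn.2⟩)
      fun h' => h'.subset fun n hn => ⟨h hn.1, hn.2⟩
  -- Goodness for `n` concerns only the finitely many formulas coded below `n`, so it is reached by
  -- finitely many thinnings.
  obtain ⟨N, -, hN, hR⟩ := exists_infinite_diagonal (R := fun n N => ∀ i, e i < n → C i N)
    (fun n M N h H i hi => hC h (H i hi)) (by
      intro n
      induction n with
      | zero => exact fun M hM => ⟨M, subset_rfl, hM, by simp⟩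
      | succ n ih =>
        intro M hM
        obtain ⟨N, hNM, hN, h⟩ := ih M hM
        by_cases hn : ∃ i, e i = n
        · obtain ⟨i, rfl⟩ := hn
          obtain ⟨N', hN'N, hN', h'⟩ := exists_infinite_convergent hκ hU p i (hΔ i) hN
          refine ⟨N', hN'N.trans hNM, hN', fun j hj => ?_⟩
          rcases Nat.lt_succ_iff_lt_or_eq.1 hj with hlt | heq
          · exact hC hN'N (h j hlt)
          · rw [he heq]; exact h'
        · refine ⟨N, hNM, hN, fun j hj => h j ?_⟩
          exact (Nat.lt_succ_iff_lt_or_eq.1 hj).resolve_right fun heq => hn ⟨j, heq⟩)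
    Set.infinite_univ
  refine ⟨N, hN, fun i b => ?_⟩
  -- The tail of `N` above `n` handles formula `i`; the remaining part is finite and harmless.
  obtain ⟨n, hn, hin⟩ := hN.exists_gt (e i)
  have hfin : ∀ Q : ℕ → Prop, {m ∈ {m ∈ N | n < m} | Q m}.Finite → {m ∈ N | Q m}.Finite := by
    intro Q hQ
    refine (hQ.union (Set.finite_Iic n)).subset fun m hm => ?_
    by_cases hnm : n < m
    · exact Or.inl ⟨⟨hm.1, hnm⟩, hm.2⟩
    · exact Or.inr (not_lt.1 hnm)
  exact (hR n hn i hin b).imp (hfin _) (hfin _)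

end Convergence

end DeltaTypes

theorem mainTheorem10 {L : FirstOrder.Language.{u, v}}
    (U : Type w) [L.Structure U]
    (κ : Cardinal.{w}) (hκ : Cardinal.aleph0 < κ) (hU : DeltaTypes.IsSaturated L U κ)
    {α : Type w₁} {ι : Type w₃} [Countable ι] {γ : ι → Type w₂}
    (Δ : ∀ i, L.Formula (α ⊕ γ i)) (hΔ : ∀ i, DeltaTypes.IsNIP U (Δ i)) :
    SeqCompactSpace (DeltaTypes.DeltaType U Δ) := by
  refine ⟨fun p _ => ?_⟩
  obtain ⟨N, hN, h⟩ := DeltaTypes.exists_infinite_convergent_all hκ hU hΔ p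
  have hmono : StrictMono (Nat.nth (· ∈ N)) := Nat.nth_strictMono hN
  have hmem : ∀ k, Nat.nth (· ∈ N) k ∈ N := fun k => Nat.nth_mem_of_infinite hN k
  have hev : ∀ Q : ℕ → Prop, {n ∈ N | Q n}.Finite →
      ∀ᶠ k in Filter.atTop, ¬ Q (Nat.nth (· ∈ N) k) := by
    intro Q hQ
    have hcof := hmono.injective.tendsto_cofinite.eventually hQ.eventually_cofinite_notMem
    rw [Nat.cofinite_eq_atTop] at hcof
    exact hcof.mono fun k hk hQk => hk ⟨hmem k, hQk⟩
  obtain ⟨q, hq⟩ := DeltaTypes.DeltaType.exists_tendsto (p ∘ Nat.nth (· ∈ N)) fun i b =>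
    (h i b).symm.imp (fun hf => (hev _ hf).mono fun _ => not_not.1) (hev _)
  exact ⟨q, Set.mem_univ q, Nat.nth (· ∈ N), hmono, hq⟩
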